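/- Let $d\ge 1$ and $k \ge 1$ be integers. A map $c:\mathbb{R}^d\to\{1,\dots,k\}$ is a measurable $k$-coloring if every color class $c^{-1}(j)$ is Lebesgue measurable. A cube is a product $\prod_{i=1}^d [a_i,a_i+s]$ with $a_i\in\mathbb{R}$ and $s>0$. A splitting of this cube consists, for each direction $i$, of an integer $r_i\ge 0$ and points $a_i=y^i_0<y^i_1<\dots<y^i_{r_i}<y^i_{r_i+1}=a_i+s$; that is, the cube is cut by the $r_i$ hyperplanes $x_i=y^i_1,\dots,x_i=y^i_{r_i}$ orthogonal to the $i$-th axis, into the $\prod_{i=1}^d (r_i+1)$ cuboids $\prod_{i=1}^d[y^i_{q_i},y^i_{q_i+1}]$, $0\le q_i\le r_i$. The size of the splitting is $\max_i r_i$. The splitting is fair (for $c$) if these cuboids can be partitioned into two families, each of which captures, for every color $j$, exactly half of the Lebesgue measure of the part of the cube colored $j$. Theorem. For all integers $t,d\ge 1$ and every integer $$k\ge (t+4)^d-(t+3)^d+(t+2)^d-2^d+d(t+2)+3,$$ there is a measurable $k$-coloring of $\mathbb{R}^d$ such that no cube has a fair splitting of size at most $t$. -/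

import Mathlib

open MeasureTheory

namespace NecklaceSplitting

/-- A `k`-coloring of `ℝ^d` is measurable if every color class is Lebesgue measurable.
Lebesgue measurability is measurability with respect to the completion of Lebesgue measure,
which is `NullMeasurableSet` for the Lebesgue measure `volume` on `Fin d → ℝ`. -/
def IsMeasurableColoring {d k : ℕ} (c : (Fin d → ℝ) → Fin k) : Prop :=
  ∀ j : Fin k, NullMeasurableSet (c ⁻¹' {j}) (volume : Measure (Fin d → ℝ))

/-- An axis-aligned (nondegenerate) cube in `ℝ^d`: a product of `d` intervals of the same
positive length. -/
structure Cube (d : ℕ) where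
  /-- the left endpoints of the intervals -/
  corner : Fin d → ℝ
  /-- the common length of the intervals -/
  side : ℝ
  side_pos : 0 < side

/-- The points of the cube. -/
def Cube.toSet {d : ℕ} (Q : Cube d) : Set (Fin d → ℝ) :=
  Set.pi Set.univ fun i => Set.Icc (Q.corner i) (Q.corner i + Q.side)

/-- A splitting of a cube by hyperplanes orthogonal to the axes: in each direction `i` a sequence
`a = y_0 < y_1 < ... < y_r < y_{r+1} = b`, where `[a, b]` is the `i`-th interval of the cube and
`r = cuts i` is the number of hyperplanes `x_i = y_1, ..., x_i = y_r` in that direction. -/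
structure Splitting {d : ℕ} (Q : Cube d) where
  /-- the number of hyperplanes in each direction -/
  cuts : Fin d → ℕ
  /-- the division points in each direction, both endpoints included -/
  point : (i : Fin d) → Fin (cuts i + 2) → ℝ
  strictMono : ∀ i, StrictMono (point i)
  point_zero : ∀ i, point i 0 = Q.corner i
  point_last : ∀ i, point i (Fin.last (cuts i + 1)) = Q.corner i + Q.side

namespace Splitting

variable {d : ℕ} {Q : Cube d}

/-- The size of a splitting: the maximum number of its hyperplanes in the same direction. -/
def size (S : Splitting Q) : ℕ :=
  Finset.univ.sup S.cuts

/-- The cuboids of a splitting are indexed by choosing one of the `cuts i + 1` intervals in every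
direction `i`. -/
abbrev Index (S : Splitting Q) : Type :=
  (i : Fin d) → Fin (S.cuts i + 1)

/-- The cuboid with a given index: the product of the chosen intervals `[y_q, y_{q+1}]`. -/
def cuboid (S : Splitting Q) (q : S.Index) : Set (Fin d → ℝ) :=
  Set.pi Set.univ fun i => Set.Icc (S.point i (q i).castSucc) (S.point i (q i).succ)

/-- A splitting of a colored cube is fair if its cuboids can be partitioned into two families,
`F` and its complement, each capturing exactly half of the total measure of every color. -/
def IsFair {k : ℕ} (S : Splitting Q) (c : (Fin d → ℝ) → Fin k) : Prop :=
  ∃ F : Finset S.Index, ∀ j : Fin k,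
    ∑ q ∈ F, volume (c ⁻¹' {j} ∩ S.cuboid q) = volume (c ⁻¹' {j} ∩ Q.toSet) / 2 ∧
    ∑ q ∈ Fᶜ, volume (c ⁻¹' {j} ∩ S.cuboid q) = volume (c ⁻¹' {j} ∩ Q.toSet) / 2

end Splitting

end NecklaceSplitting

/-!
The coloring comes from the Baire category theorem; `d * (t + 2) + 2` colors are enough. All colors
but the last are encoded by a tuple of measurable sets, a point of the complete space
`Fin K → MeasuredSets volume` (`instCompleteSpaceMeasuredSets`), and the last color is a filler.

A fair splitting has a cuboid containing some nondegenerate box with rational vertices, its division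
points are bounded, and it cuts every color evenly between the two families of cuboids. Fixing the
numbers of hyperplanes, a bound on the division points, the cuboid, the rational box and one family
leaves countably many sets `evenlySplit` of bad tuples. Each of them is closed
(`isClosed_evenlySplit`), because the grids involved form a compact set and the volume that a cuboid
captures depends jointly continuously on the grid and the tuple.

Each of them also has dense complement (`dense_compl_evenlySplit`), by counting dimensions. Recolor
a small subset of the rational box so that the first `K` colors occupy there prescribed small
volumes `θ j`. For every admissible grid that subset lies in one and the same cuboid, so an even
split would force `θ` to equal, up to a fixed sign, the vector of signed volumes of the part left
unchanged. This vector is a Lipschitz function of at most `d * (t + 2)` division points, so its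
values miss a dense subset of the `K`-dimensional space (`dense_compl_image_signedVolume`), and some
small `θ` rules out all the grids at once.
-/

open MeasureTheory Set Filter Topology
open scoped ENNReal symmDiff

namespace NecklaceSplitting

/-! ### Completeness of the space of measurable sets -/

section Complete

variable {α : Type*} [MeasurableSpace α] {μ : Measure α}

/-- The distance `μ (s ∆ t)` is complete: a rapidly Cauchy sequence of sets converges to its lower
limit, by the Borel-Cantelli estimate. -/
instance instCompleteSpaceMeasuredSets : CompleteSpace (MeasuredSets μ) := by
  refine EMetric.complete_of_convergent_controlled_sequences (fun n => 2⁻¹ ^ n)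
    (fun n => ENNReal.pow_pos (by simp) n) fun s hs => ?_
  have hmeas : MeasurableSet (⋃ N, ⋂ n ≥ N, (s n : Set α)) :=
    MeasurableSet.iUnion fun N => MeasurableSet.iInter fun n => MeasurableSet.iInter fun _ => (s n).2
  let L : MeasuredSets μ := ⟨⋃ N, ⋂ n ≥ N, (s n : Set α), hmeas⟩
  have hsub : ∀ N, (s N : Set α) ∆ L ⊆ ⋃ m, ((s (m + N) : Set α) ∆ s (m + N + 1)) := by
    intro N x hx
    by_contra hcon
    simp only [mem_iUnion, not_exists] at hcon
    have hiff : ∀ m, x ∈ s (m + N) ↔ x ∈ s N := by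
      intro m
      induction m with
      | zero => simp
      | succ m ih =>
        have := hcon m
        rw [← ih, show m + 1 + N = m + N + 1 by ring]
        rw [mem_symmDiff] at this
        simp only [SetLike.mem_coe] at this
        tauto
    have hL : x ∈ (L : Set α) ↔ x ∈ s N := by
      change x ∈ (⋃ N, ⋂ n ≥ N, (s n : Set α)) ↔ _
      simp only [mem_iUnion, mem_iInter, SetLike.mem_coe]
      constructor
      · rintro ⟨M, hM⟩
        exact (hiff M).1 (hM (M + N) (by omega))
      · intro h
        refine ⟨N, fun n hn => ?_⟩
        obtain ⟨m, rfl⟩ := Nat.exists_eq_add_of_le hn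
        rw [add_comm]
        exact (hiff m).2 h
    rw [mem_symmDiff] at hx
    simp only [SetLike.mem_coe] at hx hL
    tauto
  have hle : ∀ N, edist (s N) L ≤ 2 * 2⁻¹ ^ N := by
    intro N
    calc edist (s N) L ≤ μ (⋃ m, ((s (m + N) : Set α) ∆ s (m + N + 1))) := measure_mono (hsub N)
      _ ≤ ∑' m, μ ((s (m + N) : Set α) ∆ s (m + N + 1)) := measure_iUnion_le _
      _ ≤ ∑' m : ℕ, 2⁻¹ ^ m * 2⁻¹ ^ N := by
          refine ENNReal.tsum_le_tsum fun m => ?_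
          rw [← pow_add]
          exact (hs (m + N) (m + N) (m + N + 1) le_rfl (by omega)).le
      _ = 2 * 2⁻¹ ^ N := by
          rw [ENNReal.tsum_mul_right, ENNReal.tsum_geometric, ENNReal.one_sub_inv_two, inv_inv]
  refine ⟨L, tendsto_iff_edist_tendsto_0.2 ?_⟩
  refine tendsto_of_tendsto_of_tendsto_of_le_of_le tendsto_const_nhds ?_ (fun _ => zero_le) hle
  have := ENNReal.Tendsto.const_mul (a := 2)
    (ENNReal.tendsto_pow_atTop_nhds_zero_of_lt_one (r := 2⁻¹) (by simp)) (Or.inr (by simp))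
  simpa using this

end Complete


/-! ### Volumes of boxes -/

section Boxes

variable {ι : Type*} [Fintype ι]

/-- A Lipschitz constant, in the sup distance of the two vertices, for the volume of the part of a
box in `[-R, R]^ι` that leaves another box. It counts two slabs for each coordinate. -/
noncomputable def boxLipschitzConst (ι : Type*) [Fintype ι] (R : ℝ) : ℝ≥0∞ :=
  Fintype.card ι * (2 * ENNReal.ofReal (2 * R) ^ (Fintype.card ι - 1))

lemma boxLipschitzConst_ne_top (R : ℝ) : boxLipschitzConst ι R ≠ ∞ := by
  unfold boxLipschitzConst
  finiteness

lemma volume_slab_le [DecidableEq ι] (R : ℝ) (i : ι) (a b : ℝ) :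
    volume (Set.pi univ (Function.update (fun _ : ι => Icc (-R) R) i (Icc a b)))
      ≤ ENNReal.ofReal (2 * R) ^ (Fintype.card ι - 1) * edist a b := by
  rw [volume_pi_pi, ← Finset.mul_prod_erase _ _ (Finset.mem_univ i), mul_comm]
  gcongr
  · rw [Finset.prod_congr rfl (g := fun _ => ENNReal.ofReal (2 * R))]
    · simp [Finset.card_erase_of_mem]
    · intro j hj
      rw [Function.update_of_ne (Finset.ne_of_mem_erase hj), Real.volume_Icc]
      congr 1
      ring
  · rw [Function.update_self, Real.volume_Icc, edist_comm, edist_dist, Real.dist_eq]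
    exact ENNReal.ofReal_le_ofReal (le_abs_self _)

/-- The difference of two boxes is covered by slabs of thickness at most `δ` along their faces. -/
lemma volume_Icc_sdiff_Icc_le {R : ℝ} {a b a' b' : ι → ℝ} (ha : ∀ i, -R ≤ a i)
    (hb : ∀ i, b i ≤ R) {δ : ℝ≥0∞} (haa : ∀ i, edist (a i) (a' i) ≤ δ)
    (hbb : ∀ i, edist (b i) (b' i) ≤ δ) :
    volume (Icc a b \ Icc a' b') ≤ boxLipschitzConst ι R * δ := by
  classical
  set T := ENNReal.ofReal (2 * R) ^ (Fintype.card ι - 1)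
  have hsub : Icc a b \ Icc a' b' ⊆ ⋃ i,
      (Set.pi univ (Function.update (fun _ : ι => Icc (-R) R) i (Icc (a i) (a' i))) ∪
       Set.pi univ (Function.update (fun _ : ι => Icc (-R) R) i (Icc (b' i) (b i)))) := by
    rintro x ⟨⟨hax, hxb⟩, hx⟩
    have hR : ∀ j, x j ∈ Icc (-R) R := fun j => ⟨(ha j).trans (hax j), (hxb j).trans (hb j)⟩
    have hslab : ∀ (i : ι) (s : Set ℝ), x i ∈ s →
        x ∈ Set.pi univ (Function.update (fun _ : ι => Icc (-R) R) i s) := by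
      intro i s hs j _
      rcases eq_or_ne j i with rfl | hji
      · simpa using hs
      · simpa [Function.update_of_ne hji] using hR j
    simp only [mem_Icc, Pi.le_def, not_and_or, not_forall, not_le] at hx
    rw [mem_iUnion]
    rcases hx with ⟨i, hi⟩ | ⟨i, hi⟩
    · exact ⟨i, Or.inl (hslab i _ ⟨hax i, hi.le⟩)⟩
    · exact ⟨i, Or.inr (hslab i _ ⟨hi.le, hxb i⟩)⟩
  calc volume (Icc a b \ Icc a' b') ≤ ∑ i : ι, (T * δ + T * δ) := by
        refine (measure_mono hsub).trans ((measure_iUnion_fintype_le _ _).trans ?_)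
        refine Finset.sum_le_sum fun i _ => (measure_union_le _ _).trans (add_le_add ?_ ?_)
        · exact (volume_slab_le R i _ _).trans (by gcongr; exact haa i)
        · exact (volume_slab_le R i _ _).trans (by gcongr; rw [edist_comm]; exact hbb i)
    _ = boxLipschitzConst ι R * δ := by
        simp only [Finset.sum_const, Finset.card_univ, nsmul_eq_mul, boxLipschitzConst, T]
        ring

/-- An open box has an arbitrarily small measurable subset `E` in which `K` disjoint sets of any
prescribed, sufficiently small volumes can be found. The set `E` does not depend on the volumes. -/
lemma exists_disjoint_subsets_volume_eq [Nonempty ι] {u v : ι → ℝ} (huv : ∀ i, u i < v i) (K : ℕ)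
    {ε : ℝ≥0∞} (hε : 0 < ε) :
    ∃ E : Set (ι → ℝ), MeasurableSet E ∧ E ⊆ Set.pi univ (fun i => Ioo (u i) (v i)) ∧
      volume E < ε ∧ ∃ h : ℝ, 0 < h ∧ ∀ θ : Fin K → ℝ, (∀ j, θ j ∈ Ioo 0 h) →
        ∃ D : Fin K → Set (ι → ℝ), (∀ j, MeasurableSet (D j)) ∧ (∀ j, D j ⊆ E) ∧
          Pairwise (fun i j => Disjoint (D i) (D j)) ∧
          ∀ j, volume (D j) = ENNReal.ofReal (θ j) := by
  classical
  obtain ⟨o⟩ := ‹Nonempty ι›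
  let W : ℝ := ∏ i ∈ Finset.univ.erase o, (v i - u i)
  have hW : 0 < W := Finset.prod_pos fun i _ => sub_pos.2 (huv i)
  let B : ℝ → ℝ → Set (ι → ℝ) := fun a b =>
    Set.pi univ (Function.update (fun i => Ioo (u i) (v i)) o (Ioo a b))
  have hBmem : ∀ a b x, x ∈ B a b ↔ x o ∈ Ioo a b ∧ ∀ i, i ≠ o → x i ∈ Ioo (u i) (v i) := by
    intro a b x
    simp only [B, Set.mem_pi, mem_univ, true_imp_iff]
    constructor
    · intro h
      exact ⟨by simpa using h o, fun i hi => by simpa [Function.update_of_ne hi] using h i⟩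
    · rintro ⟨h1, h2⟩ i
      rcases eq_or_ne i o with rfl | hi
      · simpa using h1
      · simpa [Function.update_of_ne hi] using h2 i hi
  have hBmeas : ∀ a b, MeasurableSet (B a b) := by
    intro a b
    refine MeasurableSet.univ_pi fun i => ?_
    rcases eq_or_ne i o with rfl | hi
    · simp
    · simp [Function.update_of_ne hi]
  have hBvol : ∀ a b, volume (B a b) = ENNReal.ofReal ((b - a) * W) := by
    intro a b
    rw [volume_pi_pi, ← Finset.mul_prod_erase _ _ (Finset.mem_univ o), Function.update_self,
      Real.volume_Ioo, mul_comm (b - a) W, ENNReal.ofReal_mul hW.le, mul_comm]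
    congr 1
    rw [ENNReal.ofReal_prod_of_nonneg fun i _ => (sub_pos.2 (huv i)).le]
    refine Finset.prod_congr rfl fun i hi => ?_
    rw [Function.update_of_ne (Finset.ne_of_mem_erase hi), Real.volume_Ioo]
  -- a real number below `ε` that bounds the total volume to be used
  obtain ⟨η, hη0, hηε⟩ : ∃ η : ℝ, 0 < η ∧ ENNReal.ofReal η < ε := by
    obtain ⟨η, hη0, hη⟩ := ENNReal.lt_iff_exists_nnreal_btwn.1 hε
    exact ⟨η, by exact_mod_cast hη0, by simpa using hη⟩
  let δ : ℝ := min (v o - u o) (η / W) / (K + 1)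
  have hK : (0 : ℝ) < K + 1 := by positivity
  have hδ : 0 < δ := div_pos (lt_min (sub_pos.2 (huv o)) (div_pos hη0 hW)) hK
  have hKδ : (K + 1) * δ = min (v o - u o) (η / W) := by
    simp only [δ]
    field_simp
  have hKδ1 : K * δ ≤ v o - u o := by
    have := min_le_left (v o - u o) (η / W)
    linarith
  have hKδ2 : K * δ * W ≤ η := by
    have h1 := min_le_right (v o - u o) (η / W)
    have : K * δ ≤ η / W := by linarith
    calc K * δ * W ≤ η / W * W := by gcongr
      _ = η := by field_simp
  -- `E` consists of `K` consecutive slabs of thickness `δ`, one for each of the disjoint sets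
  refine ⟨B (u o) (u o + K * δ), hBmeas _ _, ?_, ?_, δ * W, mul_pos hδ hW, fun θ hθ => ?_⟩
  · intro x hx i _
    obtain ⟨h1, h2⟩ := (hBmem _ _ _).1 hx
    rcases eq_or_ne i o with rfl | hi
    · exact ⟨h1.1, h1.2.trans_le (by linarith)⟩
    · exact h2 i hi
  · rw [hBvol]
    refine (ENNReal.ofReal_le_ofReal ?_).trans_lt hηε
    linarith
  · have hθW : ∀ j, θ j / W < δ := fun j => (div_lt_iff₀ hW).2 (hθ j).2
    refine ⟨fun j => B (u o + j * δ) (u o + j * δ + θ j / W), fun j => hBmeas _ _, fun j x hx => ?_,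
      fun i j hij => ?_, fun j => ?_⟩
    · obtain ⟨h1, h2⟩ := (hBmem _ _ _).1 hx
      refine (hBmem _ _ _).2 ⟨⟨lt_of_le_of_lt ?_ h1.1, h1.2.trans_le ?_⟩, h2⟩
      · have : 0 ≤ (j : ℝ) * δ := by positivity
        linarith
      · have hj : ((j : ℕ) : ℝ) + 1 ≤ K := by exact_mod_cast j.2
        have := mul_le_mul_of_nonneg_right hj hδ.le
        linarith [hθW j]
    · refine Set.disjoint_left.2 fun x hi hj => ?_
      have hi' := ((hBmem _ _ _).1 hi).1
      have hj' := ((hBmem _ _ _).1 hj).1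
      have hlt : ∀ a b : Fin K, a < b → x o ∈ Ioo (u o + a * δ) (u o + a * δ + θ a / W) →
          x o ∈ Ioo (u o + b * δ) (u o + b * δ + θ b / W) → False := by
        intro a b hab ha hb
        have h1 : ((a : ℕ) : ℝ) + 1 ≤ b := by exact_mod_cast hab
        have := mul_le_mul_of_nonneg_right h1 hδ.le
        linarith [hθW a, ha.2, hb.1]
      rcases lt_or_gt_of_ne hij with h | h
      · exact hlt i j h hi' hj'
      · exact hlt j i h hj' hi'
    · rw [hBvol]
      congr 1
      field_simp
      ring

end Boxes

/-! ### Grids and the dimension count -/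

section Grid

variable {d : ℕ} {r : Fin d → ℕ}

/-- The division points of a grid with `r i` interior hyperplanes in direction `i`, as a point of a
finite-dimensional space; nothing is required of their order. -/
abbrev GridPoints (r : Fin d → ℕ) : Type := (i : Fin d) → Fin (r i + 2) → ℝ

/-- The cuboid with index `q` of the grid with division points `p`. -/
def gridBox (p : GridPoints r) (q : (i : Fin d) → Fin (r i + 1)) : Set (Fin d → ℝ) :=
  Set.pi univ fun i => Icc (p i (q i).castSucc) (p i (q i).succ)

lemma gridBox_eq_Icc (p : GridPoints r) (q : (i : Fin d) → Fin (r i + 1)) :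
    gridBox p q = Icc (fun i => p i (q i).castSucc) (fun i => p i (q i).succ) :=
  Set.pi_univ_Icc _ _

lemma volume_gridBox_ne_top (p : GridPoints r) (q : (i : Fin d) → Fin (r i + 1))
    (S : Set (Fin d → ℝ)) : volume (S ∩ gridBox p q) ≠ ∞ := by
  refine ne_top_of_le_ne_top ?_ (measure_mono inter_subset_right)
  rw [gridBox_eq_Icc]
  exact isCompact_Icc.measure_lt_top.ne

lemma volume_inter_gridBox_le {R : ℝ} {p p' : GridPoints r} (hp : ∀ i l, p i l ∈ Icc (-R) R)
    (q : (i : Fin d) → Fin (r i + 1)) (S S' : Set (Fin d → ℝ)) :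
    volume (S ∩ gridBox p q) ≤ volume (S' ∩ gridBox p' q) +
      (volume (S \ S') + boxLipschitzConst (Fin d) R * edist p p') := by
  have hsub : S ∩ gridBox p q ⊆
      (S' ∩ gridBox p' q) ∪ ((S \ S') ∪ (gridBox p q \ gridBox p' q)) := by
    intro x hx
    by_cases h1 : x ∈ S' <;> by_cases h2 : x ∈ gridBox p' q <;> simp_all
  refine (measure_mono hsub).trans ((measure_union_le _ _).trans ?_)
  gcongr
  refine (measure_union_le _ _).trans ?_
  gcongr
  rw [gridBox_eq_Icc, gridBox_eq_Icc]
  exact volume_Icc_sdiff_Icc_le (fun i => (hp _ _).1) (fun i => (hp _ _).2)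
    (fun i => (edist_le_pi_edist _ _ _).trans (edist_le_pi_edist _ _ _))
    (fun i => (edist_le_pi_edist _ _ _).trans (edist_le_pi_edist _ _ _))

lemma lipschitzOnWith_volume_inter_gridBox (R : ℝ) (q : (i : Fin d) → Fin (r i + 1))
    (S : Set (Fin d → ℝ)) :
    LipschitzOnWith (boxLipschitzConst (Fin d) R).toNNReal
      (fun p : GridPoints r => (volume (S ∩ gridBox p q)).toReal)
      {p | ∀ i l, p i l ∈ Icc (-R) R} := by
  refine LipschitzOnWith.of_le_add_mul _ fun p hp p' _ => ?_
  have h := volume_inter_gridBox_le (p' := p') hp q S S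
  rw [Set.sdiff_self, measure_empty, zero_add] at h
  have hC : boxLipschitzConst (Fin d) R * edist p p' ≠ ∞ :=
    ENNReal.mul_ne_top (boxLipschitzConst_ne_top R) (edist_ne_top _ _)
  have := ENNReal.toReal_mono (ENNReal.add_ne_top.2 ⟨volume_gridBox_ne_top p' q S, hC⟩) h
  rwa [ENNReal.toReal_add (volume_gridBox_ne_top p' q S) hC, ENNReal.toReal_mul,
    ← dist_edist] at this

lemma finrank_gridPoints (r : Fin d → ℕ) :
    Module.finrank ℝ (GridPoints r) = ∑ i, (r i + 2) := by
  simp [Module.finrank_pi_fintype]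

/-- The signed volumes that the two families of a grid cut out of `K` fixed sets depend in a
Lipschitz way on the division points, so they fill a set of Hausdorff dimension at most the number
of division points. With more sets than division points they miss a dense set of vectors. -/
lemma dense_compl_image_signedVolume {K : ℕ} (hK : ∑ i, (r i + 2) < K) (R : ℝ)
    (S : Fin K → Set (Fin d → ℝ)) (σ : ((i : Fin d) → Fin (r i + 1)) → ℝ) (hσ : ∀ q, |σ q| ≤ 1) :
    Dense ((fun (p : GridPoints r) (j : Fin K) =>
      ∑ q, σ q * (volume (S j ∩ gridBox p q)).toReal) '' {p | ∀ i l, p i l ∈ Icc (-R) R})ᶜ := by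
  refine dense_compl_of_dimH_lt_finrank ?_
  have hlip : LipschitzOnWith
      (∑ _q : (i : Fin d) → Fin (r i + 1), (boxLipschitzConst (Fin d) R).toNNReal)
      (fun (p : GridPoints r) (j : Fin K) => ∑ q, σ q * (volume (S j ∩ gridBox p q)).toReal)
      {p | ∀ i l, p i l ∈ Icc (-R) R} := by
    refine LipschitzOnWith.of_dist_le_mul fun p hp p' hp' => ?_
    refine (dist_pi_le_iff (by positivity)).2 fun j => ?_
    rw [NNReal.coe_sum, Finset.sum_mul]
    refine (dist_sum_sum_le _ _ _).trans (Finset.sum_le_sum fun q _ => ?_)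
    rw [Real.dist_eq, ← mul_sub, abs_mul]
    refine (mul_le_of_le_one_left (abs_nonneg _) (hσ q)).trans ?_
    exact (lipschitzOnWith_volume_inter_gridBox R q (S j)).dist_le_mul p hp p' hp'
  calc _ ≤ dimH {p : GridPoints r | ∀ i l, p i l ∈ Icc (-R) R} := hlip.dimH_image_le
    _ ≤ dimH (univ : Set (GridPoints r)) := dimH_mono (subset_univ _)
    _ = (∑ i, (r i + 2) : ℕ) := by rw [Real.dimH_univ_eq_finrank, finrank_gridPoints]
    _ < Module.finrank ℝ (Fin K → ℝ) := by
        rw [Module.finrank_fin_fun]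
        exact_mod_cast hK

end Grid

/-! ### Bad colorings form closed sets with dense complements -/

section Coloring

variable {d K : ℕ}

/-- The `j`-th color class of the coloring encoded by a tuple of measurable sets: a point gets the
least color `j` with `x ∈ A j`. Points outside all `A j` stay uncolored. -/
def colorClass (A : Fin K → MeasuredSets (volume : Measure (Fin d → ℝ))) (j : Fin K) :
    Set (Fin d → ℝ) :=
  (A j : Set (Fin d → ℝ)) \ ⋃ i < j, (A i : Set (Fin d → ℝ))

lemma measurableSet_colorClass (A : Fin K → MeasuredSets (volume : Measure (Fin d → ℝ)))
    (j : Fin K) : MeasurableSet (colorClass A j) :=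
  (A j).2.diff (MeasurableSet.iUnion fun i => MeasurableSet.iUnion fun _ => (A i).2)

lemma mem_colorClass {A : Fin K → MeasuredSets (volume : Measure (Fin d → ℝ))} {j : Fin K}
    {x : Fin d → ℝ} : x ∈ colorClass A j ↔ x ∈ A j ∧ ∀ i < j, x ∉ A i := by
  simp [colorClass]

lemma eq_of_mem_colorClass {A : Fin K → MeasuredSets (volume : Measure (Fin d → ℝ))}
    {i j : Fin K} {x : Fin d → ℝ} (hi : x ∈ colorClass A i) (hj : x ∈ colorClass A j) : i = j := by
  rw [mem_colorClass] at hi hj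
  rcases lt_trichotomy i j with h | h | h
  · exact absurd hi.1 (hj.2 i h)
  · exact h
  · exact absurd hj.1 (hi.2 j h)

lemma volume_colorClass_sdiff_le (A A' : Fin K → MeasuredSets (volume : Measure (Fin d → ℝ)))
    (j : Fin K) : volume (colorClass A j \ colorClass A' j) ≤ K * edist A A' := by
  have hsub : colorClass A j \ colorClass A' j ⊆
      ⋃ i, ((A i : Set (Fin d → ℝ)) ∆ (A' i : Set (Fin d → ℝ))) := by
    rintro x ⟨hx, hx'⟩
    by_contra hcon
    simp only [mem_iUnion, not_exists, mem_symmDiff, SetLike.mem_coe] at hcon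
    have hiff : ∀ i, x ∈ A i ↔ x ∈ A' i := fun i => by have := hcon i; tauto
    rw [mem_colorClass] at hx hx'
    simp only [hiff] at hx
    exact hx' hx
  refine (measure_mono hsub).trans ((measure_iUnion_fintype_le _ _).trans ?_)
  calc _ ≤ ∑ _i : Fin K, edist A A' := Finset.sum_le_sum fun i _ => edist_le_pi_edist A A' i
    _ = K * edist A A' := by simp

variable (r : Fin d → ℕ)

/-- The grids with division points in `[-R, R]`, nondecreasing in every direction, whose cuboid
with index `q₀` contains the box `[u, v]`. Weak inequalities make this a compact set. -/
def gridsAround (R : ℝ) (q₀ : (i : Fin d) → Fin (r i + 1)) (u v : Fin d → ℝ) :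
    Set (GridPoints r) :=
  {p | (∀ i l, p i l ∈ Icc (-R) R) ∧ (∀ i, Monotone (p i)) ∧
    ∀ i, p i (q₀ i).castSucc ≤ u i ∧ v i ≤ p i (q₀ i).succ}

/-- The tuples of sets for which some grid of `gridsAround` splits the first `K` colors evenly
between the family `F` and its complement. -/
def evenlySplit (K : ℕ) (R : ℝ) (q₀ : (i : Fin d) → Fin (r i + 1)) (u v : Fin d → ℝ)
    (F : Finset ((i : Fin d) → Fin (r i + 1))) :
    Set (Fin K → MeasuredSets (volume : Measure (Fin d → ℝ))) :=
  {A | ∃ p ∈ gridsAround r R q₀ u v, ∀ j,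
    ∑ q ∈ F, volume (colorClass A j ∩ gridBox p q) =
      ∑ q ∈ Fᶜ, volume (colorClass A j ∩ gridBox p q)}

variable {r}

lemma isCompact_gridsAround (R : ℝ) (q₀ : (i : Fin d) → Fin (r i + 1)) (u v : Fin d → ℝ) :
    IsCompact (gridsAround r R q₀ u v) := by
  have hcube : IsCompact
      (Set.pi univ fun i => Set.pi univ fun _ => Icc (-R) R : Set (GridPoints r)) :=
    isCompact_univ_pi fun i => isCompact_univ_pi fun _ => isCompact_Icc
  refine hcube.of_isClosed_subset ?_ fun p hp i _ l _ => hp.1 i l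
  have hcont : ∀ i l, Continuous fun p : GridPoints r => p i l := fun i l => by fun_prop
  simp only [gridsAround, Monotone, ofPred_and, ofPred_forall]
  refine IsClosed.inter ?_ (IsClosed.inter ?_ ?_)
  · exact isClosed_iInter fun i => isClosed_iInter fun l => isClosed_Icc.preimage (hcont i l)
  · exact isClosed_iInter fun i => isClosed_iInter fun a => isClosed_iInter fun b =>
      isClosed_iInter fun _ => isClosed_le (hcont i a) (hcont i b)
  · exact isClosed_iInter fun i =>
      (isClosed_le (hcont i _) continuous_const).inter (isClosed_le continuous_const (hcont i _))

lemma continuous_volume_colorClass_inter_gridBox {P : Set (GridPoints r)} {R : ℝ}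
    (hP : ∀ p ∈ P, ∀ i l, p i l ∈ Icc (-R) R) (q : (i : Fin d) → Fin (r i + 1)) (j : Fin K) :
    Continuous fun z : P × (Fin K → MeasuredSets (volume : Measure (Fin d → ℝ))) =>
      volume (colorClass z.2 j ∩ gridBox z.1.1 q) := by
  refine continuous_of_le_add_edist (K + boxLipschitzConst (Fin d) R)
    (ENNReal.add_ne_top.2 ⟨ENNReal.natCast_ne_top K, boxLipschitzConst_ne_top R⟩) fun z z' => ?_
  refine (volume_inter_gridBox_le (p' := z'.1.1) (hP _ z.1.2) q _ (colorClass z'.2 j)).trans ?_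
  rw [add_mul]
  gcongr
  · refine (volume_colorClass_sdiff_le _ _ j).trans ?_
    gcongr
    exact le_max_right _ _
  · exact le_max_left _ _

/-- A projection of a closed set along the compact set of grids. -/
lemma isClosed_evenlySplit (R : ℝ) (q₀ : (i : Fin d) → Fin (r i + 1)) (u v : Fin d → ℝ)
    (F : Finset ((i : Fin d) → Fin (r i + 1))) : IsClosed (evenlySplit r K R q₀ u v F) := by
  have : CompactSpace (gridsAround r R q₀ u v) :=
    isCompact_iff_compactSpace.1 (isCompact_gridsAround R q₀ u v)
  have hcont := fun q (j : Fin K) => continuous_volume_colorClass_inter_gridBox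
    (P := gridsAround r R q₀ u v) (fun p hp => hp.1) q j
  have hclosed : IsClosed {z : gridsAround r R q₀ u v ×
      (Fin K → MeasuredSets (volume : Measure (Fin d → ℝ))) | ∀ j,
      ∑ q ∈ F, volume (colorClass z.2 j ∩ gridBox z.1.1 q) =
        ∑ q ∈ Fᶜ, volume (colorClass z.2 j ∩ gridBox z.1.1 q)} := by
    rw [ofPred_forall]
    exact isClosed_iInter fun j => isClosed_eq (continuous_finsetSum _ fun q _ => hcont q j)
      (continuous_finsetSum _ fun q _ => hcont q j)
  convert isClosedMap_snd_of_compactSpace _ hclosed using 1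
  ext A
  simp only [evenlySplit, mem_ofPred_eq, mem_image, Prod.exists, Subtype.exists,
    exists_eq_right, exists_prop]

lemma disjoint_gridBox {R : ℝ} {q₀ q : (i : Fin d) → Fin (r i + 1)} {u v : Fin d → ℝ}
    {p : GridPoints r} (hp : p ∈ gridsAround r R q₀ u v) (hq : q ≠ q₀) :
    Disjoint (Set.pi univ fun i => Ioo (u i) (v i)) (gridBox p q) := by
  obtain ⟨i, hi⟩ := Function.ne_iff.1 hq
  refine Set.disjoint_left.2 fun x hx hx' => ?_
  have h1 := hx i (mem_univ i)
  have h2 := hx' i (mem_univ i)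
  obtain ⟨h3, h4⟩ := hp.2.2 i
  rcases lt_or_gt_of_ne hi with h | h
  · have : p i (q i).succ ≤ p i (q₀ i).castSucc := hp.2.1 i (by
      rw [Fin.le_def]; simpa using Nat.succ_le_of_lt h)
    linarith [h1.1, h2.2]
  · have : p i (q₀ i).succ ≤ p i (q i).castSucc := hp.2.1 i (by
      rw [Fin.le_def]; simpa using Nat.succ_le_of_lt h)
    linarith [h1.2, h2.1]

lemma gridBox_superset {R : ℝ} {q₀ : (i : Fin d) → Fin (r i + 1)} {u v : Fin d → ℝ}
    {p : GridPoints r} (hp : p ∈ gridsAround r R q₀ u v) :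
    (Set.pi univ fun i => Ioo (u i) (v i)) ⊆ gridBox p q₀ := fun _ hx i hi =>
  ⟨(hp.2.2 i).1.trans (hx i hi).1.le, (hx i hi).2.le.trans (hp.2.2 i).2⟩

/-- Recoloring a small set `E` inside the box `[u, v]`, with prescribed volumes of the colors,
changes the signed volumes of the colors by an arbitrary small vector, which can be chosen outside
the Lipschitz image of the space of grids. -/
lemma dense_compl_evenlySplit [Nonempty (Fin d)] (hK : ∑ i, (r i + 2) < K) (R : ℝ)
    (q₀ : (i : Fin d) → Fin (r i + 1)) {u v : Fin d → ℝ} (huv : ∀ i, u i < v i)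
    (F : Finset ((i : Fin d) → Fin (r i + 1))) : Dense (evenlySplit r K R q₀ u v F)ᶜ := by
  intro A
  refine EMetric.mem_closure_iff.2 fun ε hε => ?_
  obtain ⟨E, hEm, hEsub, hEε, h, hh, hE⟩ := exists_disjoint_subsets_volume_eq huv K hε
  -- the sign of a cuboid, normalized to be `-1` on the family containing `q₀`
  let σ : ((i : Fin d) → Fin (r i + 1)) → ℝ := fun q => if (q ∈ F ↔ q₀ ∈ F) then -1 else 1
  have hσ : ∀ q, |σ q| ≤ 1 := fun q => by
    simp only [σ]
    split_ifs <;> simp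
  obtain ⟨θ, hθh, hθ⟩ := (dense_compl_image_signedVolume hK R
    (fun j => colorClass A j \ E) σ hσ).inter_open_nonempty (Set.pi univ fun _ => Ioo 0 h)
    (isOpen_set_pi finite_univ fun _ _ => isOpen_Ioo)
    ⟨fun _ => h / 2, fun _ _ => ⟨by positivity, by linarith⟩⟩
  obtain ⟨D, hDm, hDE, hDd, hDvol⟩ := hE θ fun j => hθh j (mem_univ j)
  let A' : Fin K → MeasuredSets (volume : Measure (Fin d → ℝ)) := fun j =>
    ⟨((A j : Set (Fin d → ℝ)) \ E) ∪ D j, ((A j).2.diff hEm).union (hDm j)⟩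
  have hmemA' : ∀ j x, x ∈ A' j ↔ (x ∈ A j ∧ x ∉ E) ∨ x ∈ D j := fun j x => Iff.rfl
  have hclass : ∀ j, colorClass A' j = (colorClass A j \ E) ∪ D j := by
    intro j
    ext x
    rw [mem_union, Set.mem_sdiff, mem_colorClass, mem_colorClass]
    simp only [hmemA']
    by_cases hxE : x ∈ E
    · simp only [hxE, not_true_eq_false, and_false, false_or, and_iff_left_iff_imp]
      exact fun hj i hij hi => Set.disjoint_left.1 (hDd hij.ne) hi hj
    · have hD : ∀ i, x ∉ D i := fun i hi => hxE (hDE i hi)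
      simp [hxE, hD]
  refine ⟨A', ?_, ?_⟩
  · rintro ⟨p, hp, hsplit⟩
    refine hθ ⟨p, hp.1, funext fun j => ?_⟩
    have hvol : ∀ q, (volume (colorClass A' j ∩ gridBox p q)).toReal =
        (volume ((colorClass A j \ E) ∩ gridBox p q)).toReal + if q = q₀ then θ j else 0 := by
      intro q
      have hdis : Disjoint ((colorClass A j \ E) ∩ gridBox p q) (D j ∩ gridBox p q) :=
        Set.disjoint_left.2 fun x hx hx' => hx.1.2 (hDE j hx'.1)
      have hmeas : MeasurableSet (D j ∩ gridBox p q) := by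
        refine (hDm j).inter ?_
        rw [gridBox_eq_Icc]
        exact measurableSet_Icc
      rw [hclass, union_inter_distrib_right, measure_union hdis hmeas,
        ENNReal.toReal_add (volume_gridBox_ne_top _ _ _) (volume_gridBox_ne_top _ _ _)]
      congr 1
      split_ifs with hq
      · subst hq
        rw [inter_eq_self_of_subset_left (((hDE j).trans hEsub).trans (gridBox_superset hp)),
          hDvol, ENNReal.toReal_ofReal (hθh j (mem_univ j)).1.le]
      · rw [((disjoint_gridBox hp hq).mono_left ((hDE j).trans hEsub)).inter_eq]
        simp
    have hreal : ∑ q ∈ F, (volume (colorClass A' j ∩ gridBox p q)).toReal =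
        ∑ q ∈ Fᶜ, (volume (colorClass A' j ∩ gridBox p q)).toReal := by
      rw [← ENNReal.toReal_sum fun q _ => volume_gridBox_ne_top p q _,
        ← ENNReal.toReal_sum fun q _ => volume_gridBox_ne_top p q _, hsplit j]
    have hsigned : ∑ q, σ q * (volume (colorClass A' j ∩ gridBox p q)).toReal = 0 := by
      rw [← Finset.sum_add_sum_compl F]
      by_cases hF : q₀ ∈ F
      · rw [Finset.sum_congr rfl (g := fun q =>
            -(volume (colorClass A' j ∩ gridBox p q)).toReal) fun q hq => by simp [σ, hF, hq],
          Finset.sum_congr (s₁ := Fᶜ) rfl (g := fun q =>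
            (volume (colorClass A' j ∩ gridBox p q)).toReal) fun q hq => by
              simp [σ, hF, Finset.mem_compl.1 hq],
          Finset.sum_neg_distrib, hreal, neg_add_cancel]
      · rw [Finset.sum_congr rfl (g := fun q =>
            (volume (colorClass A' j ∩ gridBox p q)).toReal) fun q hq => by simp [σ, hF, hq],
          Finset.sum_congr (s₁ := Fᶜ) rfl (g := fun q =>
            -(volume (colorClass A' j ∩ gridBox p q)).toReal) fun q hq => by
              simp [σ, hF, Finset.mem_compl.1 hq],
          Finset.sum_neg_distrib, hreal, add_neg_cancel]
    simp only [hvol, mul_add, Finset.sum_add_distrib, mul_ite, mul_zero, Finset.sum_ite_eq',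
      Finset.mem_univ, if_true] at hsigned
    have hσ₀ : σ q₀ = -1 := by simp [σ]
    rw [hσ₀] at hsigned
    linarith
  · rw [edist_pi_def, Finset.sup_lt_iff hε]
    refine fun j _ => (measure_mono ?_).trans_lt hEε
    rintro x (⟨hx, hx'⟩ | ⟨hx, hx'⟩)
    · by_contra hxE
      exact hx' (Or.inl ⟨hx, hxE⟩)
    · rcases hx with hx | hx
      · exact absurd hx.1 hx'
      · exact hDE j hx

end Coloring

/-! ### Generic colorings -/

section Generic

variable {d : ℕ}

/-- By the Baire category theorem, some tuple of sets is evenly split by no grid with at most `t`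
hyperplanes in each direction. -/
lemma exists_forall_notMem_evenlySplit [Nonempty (Fin d)] {t K : ℕ} (hK : d * (t + 2) < K) :
    ∃ A : Fin K → MeasuredSets (volume : Measure (Fin d → ℝ)),
      ∀ (r : Fin d → ℕ), (∀ i, r i ≤ t) → ∀ (R : ℕ) (q₀ : (i : Fin d) → Fin (r i + 1))
        (u v : Fin d → ℚ), (∀ i, u i < v i) → ∀ F : Finset ((i : Fin d) → Fin (r i + 1)),
        A ∉ evenlySplit r K R q₀ (fun i => u i) (fun i => v i) F := by
  let T := Σ r : {r : Fin d → ℕ // ∀ i, r i ≤ t}, ℕ × ((i : Fin d) → Fin (r.1 i + 1)) ×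
    {w : (Fin d → ℚ) × (Fin d → ℚ) // ∀ i, w.1 i < w.2 i} ×
    Finset ((i : Fin d) → Fin (r.1 i + 1))
  have hcount : Countable T := inferInstance
  have hdense : Dense (⋂ τ : T, (evenlySplit τ.1.1 K τ.2.1 τ.2.2.1
      (fun i => τ.2.2.2.1.1.1 i) (fun i => τ.2.2.2.1.1.2 i) τ.2.2.2.2)ᶜ) := by
    refine dense_iInter_of_isOpen (fun τ => (isClosed_evenlySplit _ _ _ _ _).isOpen_compl)
      fun τ => dense_compl_evenlySplit ?_ _ _ (fun i => by exact_mod_cast τ.2.2.2.1.2 i) _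
    refine lt_of_le_of_lt ?_ hK
    calc ∑ i, (τ.1.1 i + 2) ≤ ∑ _i : Fin d, (t + 2) :=
          Finset.sum_le_sum fun i _ => Nat.add_le_add_right (τ.1.2 i) 2
      _ = d * (t + 2) := by simp
  obtain ⟨A, hA⟩ : (⋂ τ : T, (evenlySplit τ.1.1 K τ.2.1 τ.2.2.1
      (fun i => τ.2.2.2.1.1.1 i) (fun i => τ.2.2.2.1.1.2 i) τ.2.2.2.2)ᶜ).Nonempty :=
    hdense.nonempty_iff.2 ⟨fun _ => ⟨∅, MeasurableSet.empty⟩⟩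
  refine ⟨A, fun r hr R q₀ u v huv F => ?_⟩
  exact mem_iInter.1 hA ⟨⟨r, hr⟩, R, q₀, ⟨(u, v), huv⟩, F⟩

/-- The coloring with color classes `colorClass A`, where all remaining points get the extra last
color. -/
lemma exists_coloring {K : ℕ} (A : Fin K → MeasuredSets (volume : Measure (Fin d → ℝ))) :
    ∃ c : (Fin d → ℝ) → Fin (K + 1), IsMeasurableColoring c ∧
      ∀ j : Fin K, c ⁻¹' {j.castSucc} = colorClass A j := by
  classical
  let c : (Fin d → ℝ) → Fin (K + 1) := fun x =>
    if h : ∃ j, x ∈ colorClass A j then h.choose.castSucc else Fin.last K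
  have hc : ∀ j : Fin K, c ⁻¹' {j.castSucc} = colorClass A j := by
    intro j
    ext x
    simp only [mem_preimage, mem_singleton_iff, c]
    split_ifs with h
    · rw [Fin.castSucc_inj]
      exact ⟨fun hj => hj ▸ h.choose_spec, fun hj => eq_of_mem_colorClass h.choose_spec hj⟩
    · exact ⟨fun hj => absurd hj (Fin.castSucc_lt_last j).ne', fun hj => absurd ⟨j, hj⟩ h⟩
  have hlast : c ⁻¹' {Fin.last K} = (⋃ j, colorClass A j)ᶜ := by
    ext x
    simp only [mem_preimage, mem_singleton_iff, mem_compl_iff, mem_iUnion, c]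
    split_ifs with h
    · simp [h, (Fin.castSucc_lt_last _).ne]
    · simp [h]
  refine ⟨c, fun j => ?_, hc⟩
  refine Fin.lastCases ?_ (fun j => ?_) j
  · rw [hlast]
    exact (MeasurableSet.iUnion fun j => measurableSet_colorClass A j).compl.nullMeasurableSet
  · rw [hc]
    exact (measurableSet_colorClass A j).nullMeasurableSet

/-- `K + 1` colors suffice as soon as `d * (t + 2) < K`: the last color is not used in the
dimension count, and the relation between the division points of a cube is ignored. -/
theorem exists_coloring_forall_not_isFair (hd : 1 ≤ d) {t K : ℕ} (hK : d * (t + 2) < K) :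
    ∃ c : (Fin d → ℝ) → Fin (K + 1), IsMeasurableColoring c ∧
      ∀ (Q : Cube d) (S : Splitting Q), S.size ≤ t → ¬ S.IsFair c := by
  have : Nonempty (Fin d) := ⟨⟨0, hd⟩⟩
  obtain ⟨A, hA⟩ := exists_forall_notMem_evenlySplit (d := d) hK
  obtain ⟨c, hcm, hc⟩ := exists_coloring A
  refine ⟨c, hcm, fun Q S hS ⟨F, hF⟩ => ?_⟩
  have hr : ∀ i, S.cuts i ≤ t := fun i => (Finset.le_sup (Finset.mem_univ i)).trans hS
  -- a rational box inside the cuboid with index `0`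
  have hex : ∀ i, ∃ a b : ℚ, S.point i (Fin.castSucc 0) < a ∧ a < b ∧ b < S.point i (Fin.succ 0) := by
    intro i
    obtain ⟨a, ha, ha'⟩ := exists_rat_btwn (S.strictMono i (Fin.castSucc_lt_succ (i := 0)))
    obtain ⟨b, hb, hb'⟩ := exists_rat_btwn ha'
    exact ⟨a, b, ha, by exact_mod_cast hb, hb'⟩
  choose u v hu huv hv using hex
  let p : GridPoints S.cuts := S.point
  refine hA S.cuts hr ⌈‖p‖⌉₊ (fun _ => 0) u v huv F ⟨p, ⟨fun i l => ?_, fun i =>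
    (S.strictMono i).monotone, fun i => ⟨(hu i).le, (hv i).le⟩⟩, fun j => ?_⟩
  · refine abs_le.1 ?_
    exact (norm_le_pi_norm (p i) l).trans ((norm_le_pi_norm p i).trans (Nat.le_ceil _))
  · have := hF j.castSucc
    rw [hc] at this
    exact this.1.trans this.2.symm

end Generic

end NecklaceSplitting

theorem theorem3 (t d k : ℕ) (ht : 1 ≤ t) (hd : 1 ≤ d)
    (hk : ((t : ℤ) + 4) ^ d - ((t : ℤ) + 3) ^ d + ((t : ℤ) + 2) ^ d - 2 ^ d
      + (d : ℤ) * ((t : ℤ) + 2) + 3 ≤ (k : ℤ)) :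
    ∃ c : (Fin d → ℝ) → Fin k, NecklaceSplitting.IsMeasurableColoring c ∧
      ∀ (Q : NecklaceSplitting.Cube d) (S : NecklaceSplitting.Splitting Q),
        S.size ≤ t → ¬ S.IsFair c := by
  -- the exponential terms of the bound are nonnegative together, so the linear ones are enough
  have h1 : ((t : ℤ) + 3) ^ d ≤ ((t : ℤ) + 4) ^ d := by gcongr; norm_num
  have h2 : (2 : ℤ) ^ d ≤ ((t : ℤ) + 2) ^ d := by gcongr; linarith [Int.natCast_nonneg t]
  have h3 : d * (t + 2) + 3 ≤ k := by
    zify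
    linarith
  obtain ⟨K, rfl⟩ : ∃ K, k = K + 1 := ⟨k - 1, by omega⟩
  exact NecklaceSplitting.exists_coloring_forall_not_isFair hd (by omega)
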